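/- A permutation of length $n \ge 1$ is a sequence $\sigma = \sigma(1)\ldots\sigma(n)$ containing each of the numbers $1,\ldots,n$ exactly once. The standardization $\mathrm{st}[s]$ of a sequence $s$ of $m$ distinct positive integers is the unique permutation of length $m$ whose entries are in the same relative order as those of $s$. A permutation $\pi$ of length $l$ occurs in $\sigma$ (as a consecutive pattern) at position $i$, where $1 \le i \le n-l+1$, if $\mathrm{st}[\sigma(i)\ldots\sigma(i+l-1)] = \pi$. Two collections $\Pi_1,\Pi_2$ of permutations are strongly c-Wilf equivalent if for all $n$ and $q$ the number of permutations of length $n$ with exactly $q$ occurrences (counted over all positions) of patterns from $\Pi_1$ equals the number of permutations of length $n$ with exactly $q$ occurrences of patterns from $\Pi_2$. A permutation $\pi$ of length $l$ has a nontrivial self-overlapping if there is an integer $k$ with $1<k<l$ and $\mathrm{st}[\pi(l-k+1)\ldots\pi(l)] = \mathrm{st}[\pi(1)\ldots\pi(k)]$. **Corollary.** Let $\pi_1$ and $\pi_2$ be permutations without nontrivial self-overlappings such that (i) $\pi_1$ and $\pi_2$ have the same length $l$; (ii) $\pi_1(1) = \pi_2(1)$ and $\pi_1(l) = \pi_2(l)$.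 Then the collections $\{\pi_1\}$ and $\{\pi_2\}$ are strongly c-Wilf equivalent. -/

import Mathlib

open Equiv (Perm)

namespace ConsecutivePattern

/-- The standardization `st[s]` of a sequence `s` of `n` distinct entries, as a permutation of
`Fin n`. `Tuple.sort s` lists the positions of `s` by increasing entry, so its inverse sends a
position to the rank of its entry. Positions and entries are counted from `0`. -/
def st {n : ℕ} {α : Type*} [LinearOrder α] (s : Fin n → α) : Perm (Fin n) :=
  (Tuple.sort s)⁻¹

/-- `st[s]` has the same relative order of entries as `s`. -/
theorem st_lt_st_iff {n : ℕ} {α : Type*} [LinearOrder α] {s : Fin n → α}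
    (hs : Function.Injective s) (i j : Fin n) : st s i < st s j ↔ s i < s j := by
  have h : StrictMono (s ∘ Tuple.sort s) :=
    (Tuple.monotone_sort s).strictMono_of_injective (hs.comp (Tuple.sort s).injective)
  have h' := h.lt_iff_lt (a := st s i) (b := st s j)
  simpa [st] using h'.symm

/-- `st[s]` is the only permutation with the same relative order of entries as `s`. -/
theorem st_eq_iff {n : ℕ} {α : Type*} [LinearOrder α] {s : Fin n → α}
    (hs : Function.Injective s) (π : Perm (Fin n)) :
    st s = π ↔ ∀ i j, π i < π j ↔ s i < s j := by
  constructor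
  · rintro rfl
    exact st_lt_st_iff hs
  · intro h
    have hm : Monotone (s ∘ (π⁻¹ : Perm (Fin n))) := by
      intro a b hab
      by_contra hlt
      have := (h (π⁻¹ b) (π⁻¹ a)).2 (not_le.1 hlt)
      rw [← Equiv.Perm.mul_apply, ← Equiv.Perm.mul_apply, mul_inv_cancel] at this
      exact absurd hab (not_le.2 this)
    have hq := Tuple.comp_sort_eq_comp_iff_monotone.2 hm
    have he : π⁻¹ = Tuple.sort s := by
      ext1 a
      exact hs (congrFun hq a)
    rw [st, ← he, inv_inv]

/-- The word formed by the `l` consecutive entries of `σ` that start at position `i`. -/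
def window {n : ℕ} (σ : Perm (Fin n)) (i l : ℕ) (h : i + l ≤ n) : Fin l → Fin n :=
  fun a => σ ⟨i + a, by omega⟩

/-- A pattern: a permutation of some positive length. -/
structure Pattern where
  len : ℕ
  len_pos : 0 < len
  perm : Perm (Fin len)

namespace Pattern

/-- The first entry of a pattern (entries are counted from `0`). -/
def firstEntry (π : Pattern) : ℕ :=
  (π.perm ⟨0, π.len_pos⟩ : ℕ)

/-- The last entry of a pattern (entries are counted from `0`). -/
def lastEntry (π : Pattern) : ℕ :=
  (π.perm ⟨π.len - 1, Nat.sub_lt π.len_pos Nat.one_pos⟩ : ℕ)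

/-- `π` occurs in `σ` as a consecutive pattern, starting at position `i`. -/
def OccursAt (π : Pattern) {n : ℕ} (σ : Perm (Fin n)) (i : ℕ) : Prop :=
  ∃ h : i + π.len ≤ n, st (window σ i π.len h) = π.perm

/-- The pair `(π, π')` `k`-overlaps, where `1 ≤ k ≤ min(l, l')`: the last `k` entries of `π` and
the first `k` entries of `π'` have the same standardization. -/
def Overlaps (π π' : Pattern) (k : ℕ) : Prop :=
  0 < k ∧ ∃ (h : k ≤ π.len) (h' : k ≤ π'.len),
    st (window π.perm (π.len - k) k (Nat.sub_add_cancel h).le) =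
      st (window π'.perm 0 k ((Nat.zero_add k).trans_le h'))

/-- Every pattern overlaps itself in one entry and in all of its entries; these are the trivial
self-overlappings. A nontrivial one has length strictly between `1` and the length of `π`. -/
def HasNontrivialSelfOverlap (π : Pattern) : Prop :=
  ∃ k, 1 < k ∧ k < π.len ∧ π.Overlaps π k

end Pattern

/-- The occurrences in `σ` of patterns from `P`: the pairs of a pattern from `P` and a position
of `σ` at which it occurs. -/
def occurrences (P : Set Pattern) {n : ℕ} (σ : Perm (Fin n)) : Set (Pattern × ℕ) :=
  {p | p.1 ∈ P ∧ p.1.OccursAt σ p.2}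

/-- There are only finitely many occurrences, so `Set.ncard` counts them. -/
theorem finite_occurrences (P : Set Pattern) {n : ℕ} (σ : Perm (Fin n)) :
    (occurrences P σ).Finite := by
  let f : Fin (n + 1) × (Σ l : Fin n, Perm (Fin (l + 1))) → Pattern × ℕ :=
    fun x => (⟨x.2.1 + 1, Nat.succ_pos _, x.2.2⟩, x.1)
  refine (Set.finite_range f).subset ?_
  rintro ⟨⟨l, hl, π⟩, i⟩ ⟨-, h, -⟩
  obtain ⟨m, rfl⟩ : ∃ m, l = m + 1 := ⟨l - 1, by omega⟩
  simp only at h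
  exact ⟨(⟨i, by omega⟩, ⟨⟨m, by omega⟩, π⟩), rfl⟩

/-- `α_{n,q}`: the number of permutations of length `n` with exactly `q` occurrences of patterns
from `P`. -/
noncomputable def countWithOccurrences (P : Set Pattern) (n q : ℕ) : ℕ :=
  {σ : Perm (Fin n) | (occurrences P σ).ncard = q}.ncard

/-- Strong c-Wilf equivalence of two collections of patterns. -/
def StronglyCWilfEquivalent (P₁ P₂ : Set Pattern) : Prop :=
  ∀ n q : ℕ, countWithOccurrences P₁ n q = countWithOccurrences P₂ n q

end ConsecutivePattern

namespace ConsecutivePattern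

/-! Fix a set `S` of positions. Since `π₁` has no nontrivial self-overlapping, two of its
occurrences share at most one entry, necessarily an end of each window. Rearranging the positions
inside each window of `S` by `π₁⁻¹ * π₂` turns `π₁` into `π₂` there; the ends stay fixed because the
patterns agree at them, so the windows do not interfere. Hence as many permutations have `π₁` at all
of `S` as have `π₂` there (`card_subset_positions_le`, used in both directions). Inclusion-exclusion
passes from "at least `S`" to "exactly `S`". -/

/-- If two set-valued statistics agree on the number of points whose value contains `S`, for every
`S`, then they have the same distribution. -/
theorem card_fiber_eq_of_card_superset_eq {X ι : Type*} [Fintype X] [Fintype ι] [DecidableEq ι]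
    (f g : X → Finset ι)
    (h : ∀ S : Finset ι, (Finset.univ.filter fun x => S ⊆ f x).card =
      (Finset.univ.filter fun x => S ⊆ g x).card) (S : Finset ι) :
    (Finset.univ.filter fun x => f x = S).card = (Finset.univ.filter fun x => g x = S).card := by
  have key : ∀ (u : X → Finset ι) (S : Finset ι),
      (Finset.univ.filter fun x => S ⊆ u x).card =
        (Finset.univ.filter fun x => u x = S).card +
        ∑ T ∈ Finset.univ.filter (fun T => S ⊂ T), (Finset.univ.filter fun x => u x = T).card := by
    intro u S
    have h1 : (Finset.univ.filter fun T : Finset ι => S ⊆ T) =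
        insert S (Finset.univ.filter fun T => S ⊂ T) := by
      ext T
      simp only [Finset.mem_filter, Finset.mem_univ, true_and, Finset.mem_insert]
      rw [eq_comm (a := T)]
      exact le_iff_eq_or_lt
    rw [← Finset.sum_insert (s := Finset.univ.filter fun T => S ⊂ T) (a := S)
        (f := fun T => (Finset.univ.filter fun x => u x = T).card) (by simp), ← h1,
      Finset.card_eq_sum_card_fiberwise (f := u) (t := Finset.univ.filter fun T => S ⊆ T)
        (by intro x hx; simpa using hx)]
    refine Finset.sum_congr rfl fun T hT => congrArg _ ?_
    ext x
    simp only [Finset.mem_filter, Finset.mem_univ, true_and] at hT ⊢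
    constructor
    · exact fun hx => hx.2
    · rintro rfl
      exact ⟨hT, rfl⟩
  -- Downward induction: the strict supersets of `S` are already settled, and their contributions
  -- cancel.
  induction S using WellFoundedGT.induction with
  | ind S ih =>
    have hs := h S
    rw [key f, key g, Finset.sum_congr rfl fun T hT => ih T (Finset.mem_filter.1 hT).2] at hs
    exact Nat.add_right_cancel hs

/-- `p` occurs in `σ` at position `i`, in terms of the relative order of entries. -/
def OrderOccurs {l n : ℕ} (p : Perm (Fin l)) (σ : Perm (Fin n)) (i : ℕ) : Prop :=
  ∃ h : i + l ≤ n, ∀ a b : Fin l,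
    p a < p b ↔ σ ⟨i + a, by omega⟩ < σ ⟨i + b, by omega⟩

theorem window_injective {n : ℕ} (σ : Perm (Fin n)) (i l : ℕ) (h : i + l ≤ n) :
    Function.Injective (window σ i l h) := by
  intro a b hab
  have := σ.injective hab
  simp only [Fin.mk.injEq] at this
  exact Fin.ext (by omega)

theorem occursAt_iff_orderOccurs (π : Pattern) {n : ℕ} (σ : Perm (Fin n)) (i : ℕ) :
    π.OccursAt σ i ↔ OrderOccurs π.perm σ i :=
  exists_congr fun h => st_eq_iff (window_injective σ i π.len h) π.perm

/-- Two occurrences of a pattern at a distance less than `l - 1` produce a nontrivial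
self-overlapping. -/
theorem hasNontrivialSelfOverlap_of_orderOccurs {π : Pattern} {n : ℕ} {σ : Perm (Fin n)}
    {i j : ℕ} (hi : OrderOccurs π.perm σ i) (hj : OrderOccurs π.perm σ j) (hij : i < j)
    (hji : j + 1 < i + π.len) : π.HasNontrivialSelfOverlap := by
  obtain ⟨hin, hi⟩ := hi
  obtain ⟨hjn, hj⟩ := hj
  -- The overlap is the common part of the two windows.
  refine ⟨π.len - (j - i), by omega, by omega, by omega, by omega, by omega, ?_⟩
  rw [st_eq_iff (window_injective _ _ _ _)]
  intro a b
  rw [st_lt_st_iff (window_injective _ _ _ _)]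
  simp only [window]
  rw [hj, hi]
  have e : ∀ c : ℕ, i + (π.len - (π.len - (j - i)) + c) = j + (0 + c) := by omega
  simp only [e]

/-- The embedding of the positions of a window into all positions. -/
def windowEmbedding {n l : ℕ} (i : ℕ) (h : i + l ≤ n) : Fin l ↪ Fin n where
  toFun a := ⟨i + a, by omega⟩
  inj' a b hab := by
    simp only [Fin.mk.injEq] at hab
    exact Fin.ext (by omega)

/-- The rearrangement of positions that acts by `ρ` on the window at `i`. -/
def windowPerm {n l : ℕ} (ρ : Perm (Fin l)) (i : ℕ) (h : i + l ≤ n) : Perm (Fin n) :=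
  ρ.viaFintypeEmbedding (windowEmbedding i h)

theorem windowPerm_apply {n l : ℕ} (ρ : Perm (Fin l)) (i : ℕ) (h : i + l ≤ n) (a : Fin l) :
    windowPerm ρ i h ⟨i + a, by omega⟩ = ⟨i + ρ a, by omega⟩ :=
  ρ.viaFintypeEmbedding_apply_image (windowEmbedding i h) a

theorem windowPerm_apply_of_not_interior {n l : ℕ} {ρ : Perm (Fin l)} {i : ℕ} (h : i + l ≤ n)
    (hρ : ∀ a : Fin l, (a : ℕ) = 0 ∨ (a : ℕ) + 1 = l → ρ a = a) (x : Fin n)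
    (hx : (x : ℕ) ≤ i ∨ i + l ≤ x + 1) : windowPerm ρ i h x = x := by
  by_cases hw : i ≤ x ∧ (x : ℕ) < i + l
  · obtain ⟨a, ha⟩ : ∃ a : Fin l, i + (a : ℕ) = x := ⟨⟨x - i, by omega⟩, by simp; omega⟩
    have hx' : x = ⟨i + a, by omega⟩ := Fin.ext ha.symm
    simp only [hx', windowPerm_apply, hρ a (by omega)]
  · refine ρ.viaFintypeEmbedding_apply_notMem_range (windowEmbedding i h) ?_
    rintro ⟨a, rfl⟩
    exact hw ⟨Nat.le_add_right _ _, Nat.add_lt_add_left a.isLt _⟩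

/-- Entries in relative order `p`, read at positions permuted by `p⁻¹ * q`, have relative order `p *
(p⁻¹ * q) = q`. -/
theorem orderOccurs_mul_windowPerm {n l : ℕ} (p q : Perm (Fin l)) (σ : Perm (Fin n)) (i : ℕ)
    (h : i + l ≤ n) :
    OrderOccurs q (σ * windowPerm (p⁻¹ * q) i h) i ↔ OrderOccurs p σ i := by
  refine exists_congr fun _ => ?_
  simp only [Perm.mul_apply, windowPerm_apply]
  constructor
  · intro H a b
    simpa using H (q⁻¹ (p a)) (q⁻¹ (p b))
  · intro H a b
    simpa using H (p⁻¹ (q a)) (p⁻¹ (q b))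

theorem orderOccurs_mul_windowPerm_of_far {n l : ℕ} (p ρ : Perm (Fin l))
    (hρ : ∀ a : Fin l, (a : ℕ) = 0 ∨ (a : ℕ) + 1 = l → ρ a = a) (σ : Perm (Fin n)) {i j : ℕ}
    (h : i + l ≤ n) (hij : i + l ≤ j + 1 ∨ j + l ≤ i + 1) :
    OrderOccurs p (σ * windowPerm ρ i h) j ↔ OrderOccurs p σ j := by
  refine exists_congr fun _ => ?_
  refine forall_congr' fun a => forall_congr' fun b => ?_
  rw [Perm.mul_apply, Perm.mul_apply,
    windowPerm_apply_of_not_interior h hρ _ (by simp only; omega),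
    windowPerm_apply_of_not_interior h hρ _ (by simp only; omega)]

/-- For well separated positions, a single rearrangement of positions turns the occurrences of `p`
there into occurrences of `q`. -/
theorem exists_perm_orderOccurs_iff {n l : ℕ} (p q : Perm (Fin l))
    (hpq : ∀ a : Fin l, (a : ℕ) = 0 ∨ (a : ℕ) + 1 = l → p a = q a) (S : Finset ℕ)
    (hS : ∀ i ∈ S, i + l ≤ n)
    (hsep : ∀ i ∈ S, ∀ j ∈ S, i < j → i + l ≤ j + 1) :
    ∃ τ : Perm (Fin n), ∀ σ : Perm (Fin n),
      (∀ i ∈ S, OrderOccurs q (σ * τ) i ↔ OrderOccurs p σ i) ∧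
      ∀ j, (∀ i ∈ S, i + l ≤ j + 1 ∨ j + l ≤ i + 1) → ∀ r : Perm (Fin l),
        (OrderOccurs r (σ * τ) j ↔ OrderOccurs r σ j) := by
  have hρ : ∀ a : Fin l, (a : ℕ) = 0 ∨ (a : ℕ) + 1 = l → (p⁻¹ * q) a = a := by
    intro a ha
    simp [← hpq a ha]
  -- The clause on distant `j` strengthens the induction: the rearrangement built for `S` leaves the
  -- window of a newly inserted position undisturbed.
  induction S using Finset.induction_on with
  | empty => exact ⟨1, by simp⟩
  | insert i S hi ih =>
    obtain ⟨τ, hτ⟩ := ih (fun j hj => hS j (by simp [hj]))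
      (fun j hj k hk => hsep j (by simp [hj]) k (by simp [hk]))
    have hin : i + l ≤ n := hS i (by simp)
    have hfar : ∀ j ∈ S, i + l ≤ j + 1 ∨ j + l ≤ i + 1 := by
      intro j hj
      rcases lt_trichotomy i j with hlt | rfl | hlt
      · exact Or.inl (hsep i (by simp) j (by simp [hj]) hlt)
      · exact absurd hj hi
      · exact Or.inr (hsep j (by simp [hj]) i (by simp) hlt)
    refine ⟨τ * windowPerm (p⁻¹ * q) i hin, fun σ => ⟨fun j hj => ?_, fun j hj r => ?_⟩⟩
    · rw [← mul_assoc]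
      rcases Finset.mem_insert.1 hj with rfl | hj
      · rw [orderOccurs_mul_windowPerm]
        exact (hτ σ).2 _ (fun k hk => (hfar k hk).symm) p
      · rw [orderOccurs_mul_windowPerm_of_far _ _ hρ _ _ (hfar j hj)]
        exact (hτ σ).1 j hj
    · rw [← mul_assoc, orderOccurs_mul_windowPerm_of_far _ _ hρ _ _ (hj i (by simp))]
      exact (hτ σ).2 j (fun k hk => hj k (by simp [hk])) r

open Classical in
/-- The set of positions at which `π` occurs in `σ`. -/
noncomputable def positions (π : Pattern) {n : ℕ} (σ : Perm (Fin n)) : Finset (Fin (n + 1)) :=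
  Finset.univ.filter fun i => π.OccursAt σ i

theorem mem_positions {π : Pattern} {n : ℕ} {σ : Perm (Fin n)} {i : Fin (n + 1)} :
    i ∈ positions π σ ↔ OrderOccurs π.perm σ i := by
  simp [positions, occursAt_iff_orderOccurs]

theorem ncard_occurrences_singleton (π : Pattern) {n : ℕ} (σ : Perm (Fin n)) :
    (occurrences {π} σ).ncard = (positions π σ).card := by
  have h : occurrences {π} σ = (fun i : Fin (n + 1) => (π, (i : ℕ))) '' positions π σ := by
    ext ⟨ρ, i⟩
    simp only [occurrences, Set.mem_singleton_iff, Set.mem_ofPred_eq, Set.mem_image,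
      Finset.mem_coe, Prod.mk.injEq, positions, Finset.mem_filter, Finset.mem_univ, true_and]
    constructor
    · rintro ⟨rfl, h⟩
      obtain ⟨hn, -⟩ := id h
      exact ⟨⟨i, by omega⟩, h, rfl, rfl⟩
    · rintro ⟨j, h, rfl, rfl⟩
      exact ⟨rfl, h⟩
  rw [h, Set.ncard_image_of_injective, Set.ncard_coe_finset]
  intro i j hij
  exact Fin.ext (congrArg Prod.snd hij)

theorem card_subset_positions_le {l : ℕ} (hl : 0 < l) (p q : Perm (Fin l))
    (hp : ¬ Pattern.HasNontrivialSelfOverlap ⟨l, hl, p⟩)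
    (hpq : ∀ a : Fin l, (a : ℕ) = 0 ∨ (a : ℕ) + 1 = l → p a = q a) {n : ℕ}
    (S : Finset (Fin (n + 1))) :
    (Finset.univ.filter fun σ : Perm (Fin n) => S ⊆ positions ⟨l, hl, p⟩ σ).card ≤
      (Finset.univ.filter fun σ : Perm (Fin n) => S ⊆ positions ⟨l, hl, q⟩ σ).card := by
  -- Either there is nothing to bound, or a single witness `σ₀` already forces the windows of `S` to
  -- fit and to be well separated.
  rcases Finset.eq_empty_or_nonempty
    (Finset.univ.filter fun σ : Perm (Fin n) => S ⊆ positions ⟨l, hl, p⟩ σ) with h0 | ⟨σ₀, h₀⟩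
  · simp [h0]
  have h₀ : ∀ i ∈ S, OrderOccurs p σ₀ i := fun i hi =>
    mem_positions.1 ((Finset.mem_filter.1 h₀).2 hi)
  obtain ⟨τ, hτ⟩ := exists_perm_orderOccurs_iff (n := n) p q hpq (S.image Fin.val)
    (by
      simp only [Finset.mem_image]
      rintro _ ⟨i, hi, rfl⟩
      exact (h₀ i hi).1)
    (by
      simp only [Finset.mem_image]
      rintro _ ⟨i, hi, rfl⟩ _ ⟨j, hj, rfl⟩ hij
      by_contra hc
      exact hp (hasNontrivialSelfOverlap_of_orderOccurs (π := ⟨l, hl, p⟩) (h₀ i hi) (h₀ j hj) hij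
        (by simpa using hc)))
  refine Finset.card_le_card_of_injOn (fun σ => σ * τ) ?_ (mul_left_injective τ).injOn
  intro σ hσ
  simp only [Finset.coe_filter, Finset.mem_univ, true_and, Set.mem_ofPred_eq] at hσ ⊢
  intro i hi
  exact mem_positions.2 (((hτ σ).1 i (Finset.mem_image_of_mem _ hi)).2 (mem_positions.1 (hσ hi)))

theorem countWithOccurrences_singleton (π : Pattern) (n q : ℕ) :
    countWithOccurrences {π} n q =
      ∑ S ∈ Finset.univ.filter (fun S : Finset (Fin (n + 1)) => S.card = q),
        (Finset.univ.filter fun σ : Perm (Fin n) => positions π σ = S).card := by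
  have h : {σ : Perm (Fin n) | (occurrences {π} σ).ncard = q} =
      (Finset.univ.filter fun σ : Perm (Fin n) => (positions π σ).card = q : Finset _) := by
    ext σ
    simp [ncard_occurrences_singleton]
  rw [countWithOccurrences, h, Set.ncard_coe_finset,
    Finset.card_eq_sum_card_fiberwise (f := fun σ => positions π σ)
      (t := Finset.univ.filter (fun S : Finset (Fin (n + 1)) => S.card = q))
      (by intro σ hσ; simpa using hσ)]
  refine Finset.sum_congr rfl fun S hS => congrArg _ ?_
  ext σ
  simp only [Finset.mem_filter, Finset.mem_univ, true_and] at hS ⊢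
  constructor
  · exact fun h => h.2
  · rintro rfl
    exact ⟨hS, rfl⟩

end ConsecutivePattern

theorem corollary1p4 (π₁ π₂ : ConsecutivePattern.Pattern)
    (h₁ : ¬ π₁.HasNontrivialSelfOverlap)
    (h₂ : ¬ π₂.HasNontrivialSelfOverlap)
    (hlen : π₁.len = π₂.len)
    (hfirst : π₁.firstEntry = π₂.firstEntry)
    (hlast : π₁.lastEntry = π₂.lastEntry) :
    ConsecutivePattern.StronglyCWilfEquivalent {π₁} {π₂} := by
  obtain ⟨l, hl, p⟩ := π₁
  obtain ⟨l', hl', q⟩ := π₂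
  obtain rfl : l = l' := hlen
  have hpq : ∀ a : Fin l, (a : ℕ) = 0 ∨ (a : ℕ) + 1 = l → p a = q a := by
    rintro a (ha | ha)
    · obtain rfl : a = ⟨0, hl⟩ := Fin.ext ha
      exact Fin.ext hfirst
    · rw [show a = ⟨l - 1, Nat.sub_lt hl Nat.one_pos⟩ from Fin.ext (Nat.eq_sub_of_add_eq ha)]
      exact Fin.ext hlast
  intro n q'
  rw [ConsecutivePattern.countWithOccurrences_singleton,
    ConsecutivePattern.countWithOccurrences_singleton]
  refine Finset.sum_congr rfl fun S _ => ?_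
  refine ConsecutivePattern.card_fiber_eq_of_card_superset_eq _ _ (fun T => le_antisymm ?_ ?_) S
  · exact ConsecutivePattern.card_subset_positions_le hl p q h₁ hpq T
  · exact ConsecutivePattern.card_subset_positions_le hl q p h₂ (fun a ha => (hpq a ha).symm) T
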